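/- Let $H$ be a finite connected graph, loops and multiple edges allowed, with vertices $v_1,\dots,v_r$ and edge set $E$. Orient each edge $e$ arbitrarily, from a vertex $t(e)$ to a vertex $h(e)$, and let $\alpha(e)\in\mathbb{Z}$ be its voltage; the same edge taken in the opposite direction, from $h(e)$ to $t(e)$, has voltage $-\alpha(e)$. For a positive integer $n$, let $H_n$ be the $n$-fold cyclic covering of $H$ derived from the voltages modulo $n$: its vertices are the pairs $(v_i,s)$ with $s\in\mathbb{Z}/n\mathbb{Z}$, and each edge $e$ of $H$ gives rise to the $n$ edges joining $(t(e),s)$ to $(h(e),s+\alpha(e))$, $s\in\mathbb{Z}/n\mathbb{Z}$. Let $P(z)=\det\bigl(p_{ij}(z)\bigr)_{1\le i,j\le r}$ be the voltage polynomial, the Laurent polynomial with integer coefficients in which $$p_{ij}(z)=\delta_{ij}\,d(v_i)-\sum_{e:\,t(e)=v_i,\,h(e)=v_j}z^{\alpha(e)}-\sum_{e:\,h(e)=v_i,\,t(e)=v_j}z^{-\alpha(e)},$$ where $d(v_i)$ is the degree of $v_i$, each loop being counted twice. Let $\tau(G)$ denote the number of spanning trees of a graph $G$, and let $\varepsilon_n$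 be a primitive $n$-th root of unity in $\mathbb{C}$. Then $$\tau(H_n)=\frac{\tau(H)}{n}\prod_{s=1}^{n-1}P(\varepsilon_n^{s}).$$ -/

import Mathlib

open scoped Graph LaurentPolynomial

namespace Graph

/-- A (multi)graph is connected if it has a vertex and any two of its vertices are joined by a
walk. -/
def IsConnected {α β : Type*} (G : Graph α β) : Prop :=
  V(G).Nonempty ∧ ∀ x ∈ V(G), ∀ y ∈ V(G), Relation.ReflTransGen G.Adj x y

/-- A (multi)graph is acyclic if it has no cycle of any length `k + 1 ≥ 1`. A cycle consists of
distinct vertices `v 0, …, v k` and distinct edges `e 0, …, e k` such that `e i` joins `v i` to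
`v (i + 1)`, indices being taken cyclically. So a loop is a cycle (`k = 0`), and so is a pair of
parallel edges (`k = 1`). -/
def HasNoCycle {α β : Type*} (G : Graph α β) : Prop :=
  ∀ (k : ℕ) (v : Fin (k + 1) → α) (e : Fin (k + 1) → β),
    Function.Injective v → Function.Injective e → ¬ ∀ i, G.IsLink (e i) (v i) (v (i + 1))

/-- A tree is a connected graph without cycles. -/
def IsTreeGraph {α β : Type*} (G : Graph α β) : Prop :=
  G.IsConnected ∧ G.HasNoCycle

/-- The complexity `τ(G)`: the number of spanning trees of `G`, a spanning tree being given by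
the set `F` of its edges; `G.restrict F` has all the vertices of `G` and the edges in `F`. -/
noncomputable def complexity {α β : Type*} (G : Graph α β) : ℕ :=
  {F : Set β | F ⊆ E(G) ∧ (G.restrict F).IsTreeGraph}.ncard

end Graph

/-- A multigraph with vertex set `V` and edge set `E` (loops and multiple edges allowed) together
with an arbitrary reference orientation: the edge `e` is oriented from `tail e` to `head e`.
The opposite orientation `e⁻¹` goes from `head e` to `tail e`. -/
structure OrientedMultigraph (V E : Type*) where
  /-- The initial vertex of the reference orientation of an edge. -/
  tail : E → V
  /-- The terminal vertex of the reference orientation of an edge. -/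
  head : E → V

namespace OrientedMultigraph

/-- The underlying unoriented multigraph. -/
def toGraph {V E : Type*} (H : OrientedMultigraph V E) : Graph V E where
  vertexSet := Set.univ
  edgeSet := Set.univ
  IsLink e x y := (x = H.tail e ∧ y = H.head e) ∨ (x = H.head e ∧ y = H.tail e)
  isLink_symm := fun _ _ => ⟨fun _ _ h => by tauto⟩
  eq_or_eq_of_isLink_of_isLink := by
    rintro e x y v w (⟨rfl, rfl⟩ | ⟨rfl, rfl⟩) (⟨rfl, rfl⟩ | ⟨rfl, rfl⟩) <;> simp
  edge_mem_iff_exists_isLink := fun e =>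
    ⟨fun _ => ⟨H.tail e, H.head e, Or.inl ⟨rfl, rfl⟩⟩, fun _ => Set.mem_univ e⟩
  left_mem_of_isLink := fun _ _ _ _ => Set.mem_univ _

/-- The `n`-fold cyclic covering `H_n` derived from the integer voltages `α` reduced modulo `n`:
over a vertex `i` lie the vertices `(i, s)`, and over an edge `e` from `i` to `j` lie the edges
`(e, s)` from `(i, s)` to `(j, s + α e)`, where `s` runs over `ℤ/n`. -/
def cyclicCover {V E : Type*} (H : OrientedMultigraph V E) (α : E → ℤ) (n : ℕ) :
    OrientedMultigraph (V × ZMod n) (E × ZMod n) where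
  tail p := (H.tail p.1, p.2)
  head p := (H.head p.1, p.2 + (α p.1 : ZMod n))

/-- The degree (valency) of a vertex; every loop is counted twice. -/
def degree {V E : Type*} [DecidableEq V] [Fintype E] (H : OrientedMultigraph V E) (v : V) : ℕ :=
  (Finset.univ.filter fun e => H.tail e = v).card + (Finset.univ.filter fun e => H.head e = v).card

/-- The Laurent polynomial `∑ z ^ (voltage)`, the sum being over all oriented edges from `i` to
`j`: the edges in their reference orientation, with voltage `α e`, and the edges in the opposite
orientation, with voltage `-α e`. A loop has both orientations and contributes
`z ^ α e + z ^ (-α e)` to the diagonal. -/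
noncomputable def voltageAdjacency {V E : Type*} [DecidableEq V] [Fintype E]
    (H : OrientedMultigraph V E) (α : E → ℤ) : Matrix V V ℤ[T;T⁻¹] :=
  Matrix.of fun i j =>
    (∑ e with H.tail e = i ∧ H.head e = j, LaurentPolynomial.T (α e)) +
    (∑ e with H.head e = i ∧ H.tail e = j, LaurentPolynomial.T (-α e))

/-- The Laplacian matrix over the integer Laurent polynomials. -/
noncomputable def voltageLaplacian {V E : Type*} [DecidableEq V] [Fintype E]
    (H : OrientedMultigraph V E) (α : E → ℤ) : Matrix V V ℤ[T;T⁻¹] :=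
  Matrix.diagonal (fun v => (H.degree v : ℤ[T;T⁻¹])) - H.voltageAdjacency α

/-- The voltage polynomial `P(z)`. -/
noncomputable def voltagePolynomial {V E : Type*} [Fintype V] [DecidableEq V] [Fintype E]
    (H : OrientedMultigraph V E) (α : E → ℤ) : ℤ[T;T⁻¹] :=
  (H.voltageLaplacian α).det

end OrientedMultigraph

/-!
The proof evaluates the determinant of `L + J` for the covering graph in two ways, where `L` is the
ordinary Laplacian and `J` the all-ones matrix.

The matrix-tree theorem, in the form `det (L + x J) = x |V|² τ` (`det_laplacian_add_const`), is proved
for arbitrary multigraphs, connected or not. Here `L + x J` is `M diag(x, 1, …, 1) Mᵀ` for the signed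
incidence matrix `M` augmented by an all-ones column, and the Cauchy–Binet formula
(`Matrix.factorial_mul_det_mul`) reduces the claim to the maximal minors of `M`. A minor that does not
vanish uses the all-ones column and the edges of a connected acyclic spanning subgraph. Conversely, if
the chosen edges connect all vertices, then their columns and the all-ones vector generate a
lattice of index `|V|`, so that the minor is `±|V|` (`sq_det_eq_of_isConnected`). A spanning
tree has `|V| - 1` edges: at most that many since every edge of an acyclic set is a bridge, which
makes its columns linearly independent, and at least that many since otherwise a minor with a
repeated column would be `±|V|`.

For the covering, the discrete Fourier transform along the fibres `ℤ/n` turns `L + J` into a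
block-diagonal matrix (`fourier_mul_laplacian_mul_fourier`). The block at a nontrivial character is
the voltage Laplacian at an `n`-th root of unity `ε ^ s ≠ 1`, with determinant `P(ε ^ s)`; the block
at the trivial character is `L + n J` for the base graph, with determinant `n |V|² τ(H)`. So
`(|V| n)² τ(H_n) = n |V|² τ(H) ∏ P(ε ^ s)`, and dividing by `(|V| n)²` gives the formula.
-/

/-! ### An averaged Cauchy–Binet formula -/

/-- The Cauchy–Binet formula, summed over all maps `p : m → k` instead of over the subsets of `k` of
size `|m|`; every such subset is the image of `|m|!` injective maps, which accounts for the factor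
on the left, and the maps that are not injective contribute `0`. -/
theorem Matrix.factorial_mul_det_mul {m k R : Type*} [Fintype m] [DecidableEq m] [Fintype k]
    [CommRing R] (A : Matrix m k R) (B : Matrix k m R) :
    ((Fintype.card m).factorial : R) * (A * B).det =
      ∑ p : m → k, (A.submatrix id p).det * (B.submatrix p id).det := by
  classical
  have expand : (A * B).det =
      ∑ p : m → k, (A.submatrix id p).det * ∏ i, B (p i) i := by
    simp only [Matrix.det_apply', Matrix.mul_apply, Finset.prod_univ_sum, Finset.mul_sum,
      Fintype.piFinset_univ, Finset.sum_mul, Matrix.submatrix_apply, id_eq]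
    rw [Finset.sum_comm]
    refine Finset.sum_congr rfl fun p _ => Finset.sum_congr rfl fun σ _ => ?_
    rw [Finset.prod_mul_distrib, mul_assoc]
  have permuted (σ : Equiv.Perm m) : (A * B).det =
      ∑ p : m → k, (A.submatrix id p).det * ((Equiv.Perm.sign σ : ℤ) * ∏ i, B (p (σ i)) i) := by
    rw [expand, ← Equiv.sum_comp (Equiv.arrowCongr σ.symm (Equiv.refl k))]
    refine Finset.sum_congr rfl fun p _ => ?_
    have h : A.submatrix id (Equiv.arrowCongr σ.symm (Equiv.refl k) p) =
        (A.submatrix id p).submatrix id σ := by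
      ext i j; simp [Equiv.arrowCongr]
    rw [h, Matrix.det_permute']
    simp only [Equiv.arrowCongr, Equiv.coe_fn_mk, Function.comp_apply, Equiv.refl_apply,
      Equiv.symm_symm]
    ring
  calc ((Fintype.card m).factorial : R) * (A * B).det
      = ∑ _σ : Equiv.Perm m, (A * B).det := by
        simp [Finset.sum_const, Finset.card_univ, Fintype.card_perm]
    _ = _ := by
        rw [Finset.sum_congr rfl fun σ _ => permuted σ, Finset.sum_comm]
        refine Finset.sum_congr rfl fun p _ => ?_
        rw [← Finset.mul_sum, Matrix.det_apply' (B.submatrix p id)]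
        simp

namespace OrientedMultigraph

variable {V E : Type*}

/-! ### Bridges -/

/-- A component of the subgraph with edge set `F` contains both ends of an edge of `F` or neither. -/
theorem reflTransGen_tail_iff_head (H : OrientedMultigraph V E) {F : Set E} {e : E} (he : e ∈ F)
    (x : V) : Relation.ReflTransGen (H.toGraph.restrict F).Adj x (H.tail e) ↔
      Relation.ReflTransGen (H.toGraph.restrict F).Adj x (H.head e) := by
  have h : (H.toGraph.restrict F).IsLink e (H.tail e) (H.head e) := by
    rw [Graph.restrict_isLink]
    exact ⟨he, Or.inl ⟨rfl, rfl⟩⟩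
  exact ⟨fun h' => h'.tail ⟨e, h⟩, fun h' => h'.tail ⟨e, h.symm⟩⟩

/-- In an acyclic subgraph every edge is a bridge: a path between the ends of `e` that avoids `e`
would close up to a cycle. -/
theorem not_reflTransGen_of_hasNoCycle (H : OrientedMultigraph V E) {F : Set E}
    (hF : (H.toGraph.restrict F).HasNoCycle) {e : E} (he : e ∈ F) :
    ¬ Relation.ReflTransGen (H.toGraph.restrict (F \ {e})).Adj (H.tail e) (H.head e) := by
  classical
  intro hr
  let G' := SimpleGraph.fromRel (H.toGraph.restrict (F \ {e})).Adj
  have hreach {y : V} (hy : Relation.ReflTransGen (H.toGraph.restrict (F \ {e})).Adj (H.tail e) y) :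
      G'.Reachable (H.tail e) y := by
    induction hy with
    | refl => exact SimpleGraph.Reachable.refl _
    | @tail b c _ hbc ih =>
      refine ih.trans ?_
      by_cases h : b = c
      · exact h ▸ SimpleGraph.Reachable.refl _
      · exact SimpleGraph.Adj.reachable ((SimpleGraph.fromRel_adj _ _ _).2 ⟨h, Or.inl hbc⟩)
  obtain ⟨w, hw⟩ := (hreach hr).exists_isPath
  have hinj := hw.getVert_injOn
  have hstep (i : ℕ) (hi : i < w.length) : ∃ f, f ∈ F \ {e} ∧
      H.toGraph.IsLink f (w.getVert i) (w.getVert (i + 1)) := by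
    rcases ((SimpleGraph.fromRel_adj _ _ _).1 (w.adj_getVert_succ hi)).2 with h | h
    · obtain ⟨f, hf⟩ := h
      rw [Graph.restrict_isLink] at hf
      exact ⟨f, hf⟩
    · obtain ⟨f, hf⟩ := h
      rw [Graph.restrict_isLink] at hf
      exact ⟨f, hf.1, hf.2.symm⟩
  choose f hfF hfl using hstep
  refine hF w.length (fun i => w.getVert i) (fun i => if h : (i : ℕ) < w.length then f i h else e)
    ?_ ?_ ?_
  · intro i j hij
    exact Fin.ext (hinj (Nat.lt_succ_iff.1 i.2) (Nat.lt_succ_iff.1 j.2) hij)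
  · intro i j hij
    dsimp only at hij
    split_ifs at hij with hi hj hj
    · have h1 := hfl i hi
      have h2 := hfl j hj
      rw [← hij] at h2
      -- Both pairs of consecutive vertices are the ends of one edge; if they agreed crosswise,
      -- then `i = j + 1` and `j = i + 1`.
      rcases h1.eq_and_eq_or_eq_and_eq h2 with ⟨h, -⟩ | ⟨h, h'⟩
      · exact Fin.ext (hinj hi.le hj.le h)
      · have a := hinj hi.le (Nat.succ_le_of_lt hj) h
        have b := hinj (Nat.succ_le_of_lt hi) hj.le h'
        omega
    · exact absurd hij (hfF i hi).2
    · exact absurd hij.symm (hfF j hj).2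
    · exact Fin.ext (by omega)
  · intro i
    rw [Graph.restrict_isLink]
    split_ifs with hi
    · have : ((i + 1 : Fin (w.length + 1)) : ℕ) = i + 1 :=
        Fin.val_add_one_of_lt (Fin.lt_def.2 (by simpa using hi))
      rw [this]
      exact ⟨(hfF i hi).1, hfl i hi⟩
    · have : i = Fin.last _ := Fin.ext (by simp; omega)
      subst this
      refine ⟨he, ?_⟩
      simp only [Fin.last_add_one, Fin.val_last, Fin.val_zero, SimpleGraph.Walk.getVert_length,
        SimpleGraph.Walk.getVert_zero]
      exact Or.inr ⟨rfl, rfl⟩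

/-! ### The augmented incidence matrix -/

/-- The set of edges among the columns selected by `p`, where a column is an edge or `none`, as in
`augIncidence`. -/
def selected (p : V → Option E) : Set E := {e | some e ∈ Set.range p}

/-- The columns of `augIncidence` belonging to a set `F` of edges: `F` itself and `none`. -/
def columns (F : Set E) : Set (Option E) := insert none (some '' F)

theorem selected_eq_iff {p : V → Option E} (h0 : none ∈ Set.range p) {F : Set E} :
    selected p = F ↔ Set.range p = columns F := by
  constructor
  · rintro rfl
    ext o
    cases o <;> simp [columns, selected] at h0 ⊢
    exact h0
  · intro h
    ext e
    simp [selected, h, columns]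

section Incidence

variable [DecidableEq V]

/-- The signed incidence matrix with one further column `none`, all of whose entries are `1`. The
column of an edge `e` is `δ_{tail e} - δ_{head e}`, which is `0` for a loop. -/
def augIncidence (H : OrientedMultigraph V E) : Matrix V (Option E) ℤ :=
  Matrix.of fun v o => o.elim 1 fun e =>
    (if H.tail e = v then 1 else 0) - (if H.head e = v then 1 else 0)

@[simp]
theorem augIncidence_none (H : OrientedMultigraph V E) (v : V) : H.augIncidence v none = 1 := rfl

theorem augIncidence_some (H : OrientedMultigraph V E) (v : V) (e : E) :
    H.augIncidence v (some e) =
      (if H.tail e = v then 1 else 0) - (if H.head e = v then 1 else 0) := rfl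

theorem sum_mul_augIncidence_some [Fintype V] (H : OrientedMultigraph V E) (y : V → ℤ) (e : E) :
    ∑ v, y v * H.augIncidence v (some e) = y (H.tail e) - y (H.head e) := by
  simp [augIncidence_some, mul_sub]

variable [Fintype V]

theorem injective_of_det_ne_zero (H : OrientedMultigraph V E) {p : V → Option E}
    (h : (H.augIncidence.submatrix id p).det ≠ 0) : Function.Injective p := by
  intro i j hij
  by_contra hne
  exact h (Matrix.det_zero_of_column_eq hne fun k => by simp [hij])

/-- A function that takes equal values on the two ends of every selected edge, and has sum `0` if the
all-ones column is selected, is orthogonal to all selected columns, so it vanishes if the minor does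
not. -/
theorem eq_zero_of_det_ne_zero (H : OrientedMultigraph V E) {p : V → Option E}
    (h : (H.augIncidence.submatrix id p).det ≠ 0) (y : V → ℤ)
    (hy : ∀ e ∈ selected p, y (H.tail e) = y (H.head e))
    (hy0 : none ∈ Set.range p → ∑ v, y v = 0) : y = 0 := by
  by_contra hne
  refine h (Matrix.exists_vecMul_eq_zero_iff.1 ⟨y, hne, ?_⟩)
  ext j
  simp only [Matrix.vecMul, dotProduct, Matrix.submatrix_apply, id_eq, Pi.zero_apply]
  rcases hj : p j with _ | e
  · simpa using hy0 ⟨j, hj⟩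
  · rw [sum_mul_augIncidence_some, hy e ⟨j, hj⟩, sub_self]

theorem none_mem_range_of_det_ne_zero [Nonempty V] (H : OrientedMultigraph V E) {p : V → Option E}
    (h : (H.augIncidence.submatrix id p).det ≠ 0) : none ∈ Set.range p := by
  by_contra hn
  have := H.eq_zero_of_det_ne_zero h (fun _ => 1) (fun _ _ => rfl) fun h' => absurd h' hn
  exact one_ne_zero (congrFun this (Classical.arbitrary V))

theorem isConnected_of_det_ne_zero [Nonempty V] (H : OrientedMultigraph V E) {p : V → Option E}
    (h : (H.augIncidence.submatrix id p).det ≠ 0) :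
    (H.toGraph.restrict (selected p)).IsConnected := by
  classical
  refine ⟨Set.univ_nonempty, fun x _ y _ => ?_⟩
  by_contra hxy
  let c : V → ℤ := fun v =>
    if Relation.ReflTransGen (H.toGraph.restrict (selected p)).Adj x v then 1 else 0
  -- The indicator function of the component of `x`, corrected by a constant to have sum `0`.
  have := H.eq_zero_of_det_ne_zero h (fun v => Fintype.card V * c v - ∑ u, c u)
    (fun e he => by simp only [c, H.reflTransGen_tail_iff_head he x])
    (fun _ => by simp [Finset.sum_sub_distrib, ← Finset.mul_sum])
  have hx := congrFun this x
  have hy := congrFun this y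
  have hcx : c x = 1 := if_pos Relation.ReflTransGen.refl
  have hcy : c y = 0 := if_neg hxy
  simp only [hcx, hcy, Pi.zero_apply] at hx hy
  have : (Fintype.card V : ℤ) = 0 := by linarith
  simp at this

/-- The selected edges contain no cycle, because the columns of the edges of a cycle, with suitable
signs, have sum `0`. -/
theorem hasNoCycle_of_det_ne_zero (H : OrientedMultigraph V E) {p : V → Option E}
    (h : (H.augIncidence.submatrix id p).det ≠ 0) :
    (H.toGraph.restrict (selected p)).HasNoCycle := by
  intro k v e _ he hl
  simp only [Graph.restrict_isLink] at hl
  choose q hq using fun i => (hl i).1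
  have hs (i : Fin (k + 1)) : ∃ s : ℤ, s ≠ 0 ∧ ∀ u, s * H.augIncidence u (some (e i)) =
      (if v i = u then 1 else 0) - (if v (i + 1) = u then 1 else 0) := by
    rcases (hl i).2 with ⟨h1, h2⟩ | ⟨h1, h2⟩
    · exact ⟨1, one_ne_zero, fun u => by rw [h1, h2, augIncidence_some]; ring⟩
    · exact ⟨-1, by norm_num, fun u => by rw [h1, h2, augIncidence_some]; ring⟩
  choose s hs0 hs using hs
  refine h (Matrix.exists_mulVec_eq_zero_iff.1 ⟨∑ i, Pi.single (q i) (s i), fun h0 => ?_, ?_⟩)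
  · have hqi : Function.Injective q := fun i j hij => he (Option.some_injective _ (by
      rw [← hq i, ← hq j, hij]))
    have := congrFun h0 (q 0)
    rw [Finset.sum_apply, Finset.sum_eq_single 0] at this
    · simp at this
      exact hs0 0 this
    · intro j _ hj
      exact Pi.single_eq_of_ne (fun h => hj (hqi h).symm) _
    · simp
  · ext u
    rw [Matrix.mulVec_sum, Finset.sum_apply]
    simp only [Matrix.mulVec_single, Pi.smul_apply, Matrix.col_apply, Matrix.submatrix_apply, id_eq,
      hq, MulOpposite.smul_eq_mul_unop, MulOpposite.unop_op, Pi.zero_apply]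
    simp_rw [mul_comm _ (s _), hs, Finset.sum_sub_distrib]
    rw [sub_eq_zero]
    exact (Equiv.sum_comp (Equiv.addRight (1 : Fin (k + 1)))
      fun i => if v i = u then (1 : ℤ) else 0).symm

/-- Walking along the selected edges writes `δ_x - δ_y` as an integral combination of columns. -/
theorem exists_mulVec_of_reflTransGen (H : OrientedMultigraph V E) {p : V → Option E} {x y : V}
    (h : Relation.ReflTransGen (H.toGraph.restrict (selected p)).Adj x y) :
    ∃ w : V → ℤ, (H.augIncidence.submatrix id p).mulVec w = Pi.single x 1 - Pi.single y 1 := by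
  induction h with
  | refl => exact ⟨0, by simp⟩
  | @tail b c _ hbc ih =>
    obtain ⟨w, hw⟩ := ih
    obtain ⟨e, he⟩ := hbc
    rw [Graph.restrict_isLink] at he
    obtain ⟨⟨j, hj⟩, he⟩ := he
    have key : (H.augIncidence.submatrix id p).mulVec (Pi.single j 1) =
        Pi.single (H.tail e) 1 - Pi.single (H.head e) 1 := by
      ext u
      simp [hj, augIncidence_some, Pi.single_apply, eq_comm]
    rcases he with ⟨rfl, rfl⟩ | ⟨rfl, rfl⟩
    · exact ⟨w + Pi.single j 1, by rw [Matrix.mulVec_add, hw, key]; abel⟩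
    · exact ⟨w - Pi.single j 1, by rw [Matrix.mulVec_sub, hw, key]; abel⟩

/-- If the sum of all rows is `c y`, then `c` can be taken out of the determinant by replacing any
one row by `y`. -/
theorem det_eq_mul_det_updateRow {m R : Type*} [Fintype m] [DecidableEq m] [CommRing R]
    (A : Matrix m m R) (r : m) (c : R) (y : m → R) (h : ∀ j, ∑ i, A i j = c * y j) :
    A.det = c * (A.updateRow r y).det := by
  have hrow : (∑ k, (fun _ => (1 : R)) k • A k : m → R) = c • y := by
    ext j
    simp only [one_smul]
    exact (Finset.sum_apply j _ _).trans (h j)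
  have := Matrix.det_updateRow_sum A r fun _ => 1
  rw [one_smul] at this
  rw [← this, ← Matrix.det_updateRow_smul]
  exact congrArg (fun z => (A.updateRow r z).det) hrow

/-- The number `|V|` divides every maximal minor: adding all rows to one of them gives a row with
entries `0` and `|V|`. -/
theorem card_dvd_det [Nonempty V] (H : OrientedMultigraph V E) (p : V → Option E) :
    (Fintype.card V : ℤ) ∣ (H.augIncidence.submatrix id p).det := by
  refine ⟨_, det_eq_mul_det_updateRow _ (Classical.arbitrary V) _
    (fun j => if p j = none then 1 else 0) fun j => ?_⟩
  simp only [Matrix.submatrix_apply, id_eq]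
  rcases hj : p j with _ | e
  · simp
  · simpa using H.sum_mul_augIncidence_some 1 e

theorem exists_mul_eq_of_forall_col {m R : Type*} [Fintype m] [CommRing R] {A D : Matrix m m R}
    (h : ∀ j, ∃ w, A.mulVec w = D.col j) : ∃ W, A * W = D := by
  choose w hw using h
  refine ⟨Matrix.of fun i j => w j i, ?_⟩
  ext i j
  exact congrFun (hw j) i

/-- If the selected edges connect all vertices, then the minor is `±|V|`: its columns generate the
lattice spanned by the all-ones vector and the vectors `δ_x - δ_r`, which has index `|V|`. -/
theorem sq_det_eq_of_isConnected [Nonempty V] (H : OrientedMultigraph V E) {p : V → Option E}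
    (h0 : none ∈ Set.range p) (hc : (H.toGraph.restrict (selected p)).IsConnected) :
    (H.augIncidence.submatrix id p).det ^ 2 = (Fintype.card V : ℤ) ^ 2 := by
  classical
  let r := Classical.arbitrary V
  let D : Matrix V V ℤ := Matrix.of fun i j =>
    if j = r then 1 else (Pi.single j 1 - Pi.single r 1 : V → ℤ) i
  obtain ⟨W, hW⟩ : ∃ W, H.augIncidence.submatrix id p * W = D := by
    refine exists_mul_eq_of_forall_col fun j => ?_
    by_cases hj : j = r
    · obtain ⟨i, hi⟩ := h0
      refine ⟨Pi.single i 1, ?_⟩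
      ext u
      simp [hi, D, hj]
    · obtain ⟨w, hw⟩ := H.exists_mulVec_of_reflTransGen (hc.2 j (Set.mem_univ _) r (Set.mem_univ _))
      refine ⟨w, ?_⟩
      rw [hw]
      ext u
      simp [D, hj]
  have hD : D.det = Fintype.card V := by
    have h := det_eq_mul_det_updateRow D r (Fintype.card V) (Pi.single r 1) fun j => by
      by_cases hj : j = r
      · simp [D, hj]
      · simp [D, hj, Finset.sum_sub_distrib]
    have hone : D.updateRow r (Pi.single r 1) =
        1 + Matrix.replicateCol Unit (1 - Pi.single r 1 : V → ℤ) *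
          Matrix.replicateRow Unit (Pi.single r 1 : V → ℤ) := by
      ext i j
      by_cases hi : i = r
      · rw [hi]
        by_cases hj : j = r
        · simp [hj, Matrix.mul_apply]
        · simp [Matrix.mul_apply, hj, Matrix.one_apply_ne (Ne.symm hj)]
      · by_cases hj : j = r
        · subst hj; simp [Matrix.mul_apply, hi, D, Matrix.one_apply_ne hi]
        · simp [Matrix.mul_apply, hi, hj, D, Matrix.one_apply, Pi.single_apply]
    rw [hone, Matrix.det_one_add_replicateCol_mul_replicateRow] at h
    rw [h]
    simp
  have hdvd : (H.augIncidence.submatrix id p).det ∣ Fintype.card V := by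
    rw [← hD, ← hW, Matrix.det_mul]
    exact dvd_mul_right _ _
  rw [sq_eq_sq_iff_abs_eq_abs, Int.abs_eq_natAbs, Int.abs_eq_natAbs,
    Nat.dvd_antisymm (Int.natAbs_dvd_natAbs.2 hdvd) (Int.natAbs_dvd_natAbs.2 (H.card_dvd_det p))]

/-- The columns belonging to an acyclic set of edges are linearly independent: pairing a
relation among them with the all-ones vector isolates the coefficient of `none`, and then pairing it
with the indicator function of the component of `tail e` after deletion of `e` isolates that of `e`. -/
theorem linearIndependent_of_hasNoCycle [Nonempty V] [Fintype E] (H : OrientedMultigraph V E)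
    {F : Set E} (hF : (H.toGraph.restrict F).HasNoCycle) :
    LinearIndependent ℤ fun o : columns F => H.augIncidence.col o := by
  classical
  rw [Fintype.linearIndependent_iff]
  intro g hg
  have pair (y : V → ℤ) : ∑ o : columns F, g o * ∑ v, y v * H.augIncidence v o = 0 := by
    have := congrArg (fun z => y ⬝ᵥ z) hg
    simp only [dotProduct, Finset.sum_apply, Pi.smul_apply, Matrix.col_apply, smul_eq_mul,
      Pi.zero_apply, mul_zero, Finset.sum_const_zero, Finset.mul_sum] at this
    rw [Finset.sum_comm] at this
    simp only [Finset.mul_sum]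
    rw [← this]
    exact Finset.sum_congr rfl fun _ _ => Finset.sum_congr rfl fun _ _ => by ring
  have h0 : g ⟨none, Or.inl rfl⟩ = 0 := by
    have := pair 1
    rw [Finset.sum_eq_single ⟨none, Or.inl rfl⟩] at this
    · simpa using this
    · rintro ⟨_ | e, ho⟩ _ hne
      · exact absurd rfl hne
      · simp only [sum_mul_augIncidence_some, Pi.one_apply, sub_self, mul_zero]
    · simp
  rintro ⟨_ | e, ho⟩
  · exact h0
  · have heF : e ∈ F := by simpa [columns] using ho
    let c : V → ℤ := fun v =>
      if Relation.ReflTransGen (H.toGraph.restrict (F \ {e})).Adj (H.tail e) v then 1 else 0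
    have := pair c
    rw [Finset.sum_eq_single ⟨some e, ho⟩] at this
    · have ht : c (H.tail e) = 1 := if_pos Relation.ReflTransGen.refl
      have hh : c (H.head e) = 0 := if_neg (H.not_reflTransGen_of_hasNoCycle hF heF)
      simpa only [sum_mul_augIncidence_some, ht, hh, sub_zero, mul_one] using this
    · rintro ⟨_ | f, hf⟩ _ hne
      · rw [h0, zero_mul]
      · have hfe : f ∈ F \ {e} := ⟨by simpa [columns] using hf, fun h => hne (by
          rw [Set.mem_singleton_iff] at h; simp [h])⟩
        simp only [sum_mul_augIncidence_some, c, H.reflTransGen_tail_iff_head hfe, sub_self,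
          mul_zero]
    · simp

/-- A spanning tree has `|V| - 1` edges. -/
theorem card_columns_of_isTreeGraph [Nonempty V] [Fintype E] (H : OrientedMultigraph V E)
    {F : Set E} (hF : (H.toGraph.restrict F).IsTreeGraph) [Fintype (columns F)] :
    Fintype.card (columns F) = Fintype.card V := by
  classical
  have hle : Fintype.card (columns F) ≤ Fintype.card V := by
    simpa using (H.linearIndependent_of_hasNoCycle hF.2).fintype_card_le_finrank
  have : Nonempty (columns F) := ⟨⟨none, Or.inl rfl⟩⟩
  obtain ⟨f⟩ := Function.Embedding.nonempty_of_card_le hle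
  obtain ⟨q, hq⟩ : ∃ q : V → columns F, Function.Surjective q :=
    ⟨Function.invFun f, Function.invFun_surjective f.injective⟩
  have hr : Set.range (fun v => (q v : Option E)) = columns F := by
    rw [Set.range_comp' Subtype.val q, hq.range_eq, Set.image_univ, Subtype.range_coe]
  have h0 : none ∈ Set.range (fun v => (q v : Option E)) := by rw [hr]; exact Or.inl rfl
  -- The minor of these columns does not vanish, so no column is repeated.
  have hdet := H.sq_det_eq_of_isConnected h0 (by rw [(selected_eq_iff h0).2 hr]; exact hF.1)
  have hinj := H.injective_of_det_ne_zero (p := fun v => (q v : Option E)) fun h => by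
    rw [h] at hdet
    rw [zero_pow two_ne_zero] at hdet
    exact pow_ne_zero 2 (Nat.cast_ne_zero.2 Fintype.card_ne_zero) hdet.symm
  exact le_antisymm hle (Fintype.card_le_of_injective q fun a b hab => hinj (congrArg _ hab))

end Incidence

/-! ### The matrix-tree theorem -/

/-- The maximal minors that do not vanish are those of spanning trees. -/
theorem det_ne_zero_iff [Fintype V] [DecidableEq V] [Nonempty V] (H : OrientedMultigraph V E)
    (p : V → Option E) : (H.augIncidence.submatrix id p).det ≠ 0 ↔
      none ∈ Set.range p ∧ Function.Injective p ∧
        (H.toGraph.restrict (selected p)).IsTreeGraph := by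
  refine ⟨fun h => ⟨H.none_mem_range_of_det_ne_zero h, H.injective_of_det_ne_zero h,
    H.isConnected_of_det_ne_zero h, H.hasNoCycle_of_det_ne_zero h⟩, fun h h' => ?_⟩
  have := H.sq_det_eq_of_isConnected h.1 h.2.2.1
  rw [h'] at this
  rw [zero_pow two_ne_zero] at this
  exact pow_ne_zero 2 (Nat.cast_ne_zero.2 Fintype.card_ne_zero) this.symm

open Classical in
theorem card_injective_range_eq {m k : Type*} [Fintype m] [Fintype k] (S : Set k)
    (hS : Fintype.card S = Fintype.card m) :
    (Finset.univ.filter fun p : m → k => Function.Injective p ∧ Set.range p = S).card =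
      (Fintype.card m).factorial := by
  rw [← Fintype.card_equiv (Fintype.equivOfCardEq hS.symm : m ≃ S), ← Fintype.card_subtype]
  refine Fintype.card_congr
    { toFun := fun p => (Equiv.ofInjective p.1 p.2.1).trans (Equiv.setCongr p.2.2)
      invFun := fun f => ⟨fun i => f i, Subtype.val_injective.comp f.injective, ?_⟩
      left_inv := fun p => rfl
      right_inv := fun f => by ext; rfl }
  rw [Set.range_comp' Subtype.val f, f.surjective.range_eq, Set.image_univ, Subtype.range_coe]

/-- The diagonal weights `x` (at `none`) and `1` (at every edge): with `M` the augmented incidence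
matrix, `M diag(w) Mᵀ = L + x J`. -/
def columnWeight (x : ℤ) (o : Option E) : ℤ := o.elim x fun _ => 1

theorem prod_columnWeight [Fintype V] (x : ℤ) {p : V → Option E}
    (h0 : none ∈ Set.range p) (hp : Function.Injective p) : ∏ i, columnWeight x (p i) = x := by
  obtain ⟨j, hj⟩ := h0
  rw [Finset.prod_eq_single j, hj]
  · rfl
  · intro i _ hij
    rcases hi : p i with _ | e
    · exact absurd (hp (hi.trans hj.symm)) hij
    · rfl
  · simp

/-- **Matrix-tree theorem** for multigraphs, in the symmetric form `det (L + x J) = x |V|² τ`, where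
`L` is the Laplacian matrix and `J` is the all-ones matrix. -/
theorem det_laplacian_add_const [Fintype V] [DecidableEq V] [Nonempty V] [Fintype E]
    (H : OrientedMultigraph V E) (x : ℤ) :
    (Matrix.of fun i j => x + ∑ e, H.augIncidence i (some e) * H.augIncidence j (some e)).det =
      x * (Fintype.card V : ℤ) ^ 2 * H.toGraph.complexity := by
  classical
  let B : Matrix (Option E) V ℤ := Matrix.of fun o v => columnWeight x o * H.augIncidence v o
  have hprod : (Matrix.of fun i j =>
      x + ∑ e, H.augIncidence i (some e) * H.augIncidence j (some e)) = H.augIncidence * B := by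
    ext i j
    simp [Matrix.mul_apply, B, Fintype.sum_option, columnWeight]
  have hterm (p : V → Option E) : (H.augIncidence.submatrix id p).det * (B.submatrix p id).det =
      if (H.augIncidence.submatrix id p).det ≠ 0 then x * (Fintype.card V : ℤ) ^ 2 else 0 := by
    have hB : (B.submatrix p id).det =
        (∏ i, columnWeight x (p i)) * (H.augIncidence.submatrix id p).det := by
      rw [← Matrix.det_transpose (H.augIncidence.submatrix id p), ← Matrix.det_mul_column]
      rfl
    split_ifs with h
    · obtain ⟨h0, hp, ht⟩ := (H.det_ne_zero_iff p).1 h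
      rw [hB, prod_columnWeight x h0 hp, ← H.sq_det_eq_of_isConnected h0 ht.1]
      ring
    · rw [not_ne_iff.1 h, zero_mul]
  have hcount : (Finset.univ.filter fun p : V → Option E =>
      (H.augIncidence.submatrix id p).det ≠ 0).card =
        H.toGraph.complexity * (Fintype.card V).factorial := by
    rw [Graph.complexity, Set.ncard_eq_toFinset_card', ← smul_eq_mul]
    rw [Finset.card_eq_sum_card_fiberwise (f := selected) (t := Set.toFinset
      {F | F ⊆ E(H.toGraph) ∧ (H.toGraph.restrict F).IsTreeGraph}), Finset.sum_const_nat
      (m := (Fintype.card V).factorial), smul_eq_mul]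
    · intro F hF
      have hF := (Set.mem_toFinset.1 hF).2
      rw [← card_injective_range_eq (columns F) (H.card_columns_of_isTreeGraph hF)]
      congr 1
      ext p
      simp only [Finset.mem_filter, Finset.mem_univ, true_and, det_ne_zero_iff]
      constructor
      · rintro ⟨⟨h0, hp, -⟩, h⟩
        exact ⟨hp, (selected_eq_iff h0).1 h⟩
      · rintro ⟨hp, h⟩
        have h0 : none ∈ Set.range p := by rw [h]; exact Or.inl rfl
        have h' := (selected_eq_iff h0).2 h
        exact ⟨⟨h0, hp, h' ▸ hF⟩, h'⟩
    · intro p hp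
      simp only [Finset.coe_filter, Finset.mem_univ, true_and, Set.mem_ofPred_eq,
        det_ne_zero_iff] at hp
      simpa using ⟨Set.subset_univ _, hp.2.2⟩
  have hCB := Matrix.factorial_mul_det_mul H.augIncidence B
  simp only [hterm] at hCB
  rw [← Finset.sum_filter, Finset.sum_const, hcount, nsmul_eq_mul] at hCB
  rw [hprod]
  refine mul_left_cancel₀ (Nat.cast_ne_zero.2 (Nat.factorial_ne_zero (Fintype.card V))) ?_
  rw [hCB]
  push_cast
  ring

/-! ### Values of the voltage Laplacian -/

/-- For a unit `z`, the voltage Laplacian at `z` is a sum over the edges of the rank-one matrices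
`(δ_{tail e} - z^{-α e} δ_{head e}) (δ_{tail e} - z^{α e} δ_{head e})ᵀ`. -/
theorem map_eval_voltageLaplacian [DecidableEq V] [Fintype E] (H : OrientedMultigraph V E)
    (α : E → ℤ) (z : ℂˣ) :
    (H.voltageLaplacian α).map (LaurentPolynomial.eval₂ (Int.castRingHom ℂ) z) =
      Matrix.of fun i j => ∑ e,
        ((if H.tail e = i then 1 else 0) - (if H.head e = i then ((z ^ (-α e) : ℂˣ) : ℂ) else 0)) *
        ((if H.tail e = j then 1 else 0) - (if H.head e = j then ((z ^ α e : ℂˣ) : ℂ) else 0)) := by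
  ext i j
  have hterm (e : E) :
      ((if H.tail e = i then 1 else 0) - (if H.head e = i then ((z ^ (-α e) : ℂˣ) : ℂ) else 0)) *
        ((if H.tail e = j then 1 else 0) - (if H.head e = j then ((z ^ α e : ℂˣ) : ℂ) else 0)) =
      (if i = j then (if H.tail e = i then 1 else 0) + (if H.head e = i then 1 else 0) else 0)
        - ((if H.tail e = i ∧ H.head e = j then ((z ^ α e : ℂˣ) : ℂ) else 0) +
          (if H.head e = i ∧ H.tail e = j then ((z ^ (-α e) : ℂˣ) : ℂ) else 0)) := by
    have hz : ((z ^ (-α e) : ℂˣ) : ℂ) * ((z ^ α e : ℂˣ) : ℂ) = 1 := by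
      rw [← Units.val_mul, ← zpow_add]; simp
    generalize ((z ^ (-α e) : ℂˣ) : ℂ) = a at hz ⊢
    generalize ((z ^ α e : ℂˣ) : ℂ) = b at hz ⊢
    by_cases hij : i = j
    · subst hij
      by_cases h1 : H.tail e = i <;> by_cases h2 : H.head e = i <;> simp [h1, h2, hz]
      linear_combination hz
    · by_cases h1 : H.tail e = i <;> by_cases h2 : H.head e = i <;>
        by_cases h3 : H.tail e = j <;> by_cases h4 : H.head e = j <;>
        first
        | exact absurd (h1.symm.trans h3) hij
        | exact absurd (h2.symm.trans h4) hij
        | simp [h1, h2, h3, h4, hij, Ne.symm hij]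
  simp only [Matrix.of_apply, hterm, Finset.sum_sub_distrib, Finset.sum_add_distrib,
    Matrix.map_apply, voltageLaplacian, voltageAdjacency, Matrix.sub_apply, map_sub, map_add,
    map_sum, LaurentPolynomial.eval₂_T, Finset.sum_filter,
    apply_ite (LaurentPolynomial.eval₂ (Int.castRingHom ℂ) z),
    map_zero]
  congr 1
  · by_cases hij : i = j
    · subst hij
      simp [degree, Finset.sum_add_distrib]
    · simp [hij]

/-! ### Block-diagonalization over the cyclic group -/

/-- Conjugation of `x J + b bᵀ`, entry by entry. -/
theorem mul_laplacian_mul {m k R : Type*} [Fintype m] [Fintype k] [CommRing R]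
    (A C : Matrix m m R) (x : R) (b : m → k → R) (p q : m) :
    (A * (Matrix.of fun i j => x + ∑ e, b i e * b j e) * C) p q =
      x * (∑ i, A p i) * (∑ j, C j q) + ∑ e, (∑ i, A p i * b i e) * (∑ j, b j e * C j q) := by
  have h : (Matrix.of fun i j => x + ∑ e, b i e * b j e) =
      Matrix.replicateCol Unit (fun _ => x) * Matrix.replicateRow Unit (fun _ : m => (1 : R)) +
        Matrix.of b * (Matrix.of b).transpose := by
    ext i j
    simp [Matrix.mul_apply]
  rw [h, Matrix.mul_add, Matrix.add_mul, Matrix.add_apply]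
  congr 1
  · rw [← Matrix.mul_assoc, Matrix.mul_assoc, Matrix.mul_apply]
    simp only [Matrix.mul_apply, Matrix.replicateCol_apply, Matrix.replicateRow_apply,
      Finset.univ_unique, Finset.sum_const, Finset.card_singleton, one_smul, one_mul]
    rw [← Finset.sum_mul]
    ring
  · rw [← Matrix.mul_assoc, Matrix.mul_assoc, Matrix.mul_apply]
    simp [Matrix.mul_apply]

section Fourier

variable [DecidableEq V] {n : ℕ}

/-- The matrix of the discrete Fourier transform along the fibres of the covering, for a choice of
character `ψ` of `ℤ/n`; it acts as the identity on `V`. -/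
def fourier (V : Type*) [DecidableEq V] (ψ : AddChar (ZMod n) ℂ) :
    Matrix (V × ZMod n) (V × ZMod n) ℂ :=
  Matrix.of fun p q => if p.1 = q.1 then ψ (p.2 * q.2) else 0

/-- The value of the voltage Laplacian at the root of unity `ψ u`, as a sum of rank-one matrices over
the edges. At `u = 0` the number `n` is added to every entry: this is what the all-ones matrix of
the covering contributes to the block of the trivial character. -/
def twistedLaplacian [Fintype E] (H : OrientedMultigraph V E) (α : E → ℤ)
    (ψ : AddChar (ZMod n) ℂ) (u : ZMod n) : Matrix V V ℂ :=
  Matrix.of fun i j => (if u = 0 then (n : ℂ) else 0) + ∑ e,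
    ((if H.tail e = i then 1 else 0) - (if H.head e = i then ψ⁻¹ (u * α e) else 0)) *
    ((if H.tail e = j then 1 else 0) - (if H.head e = j then ψ (α e * u) else 0))

theorem twistedLaplacian_zero [Fintype E] (H : OrientedMultigraph V E) (α : E → ℤ)
    (ψ : AddChar (ZMod n) ℂ) : H.twistedLaplacian α ψ 0 = Matrix.of fun i j => (n : ℂ) +
      ∑ e, (H.augIncidence i (some e) : ℂ) * (H.augIncidence j (some e) : ℂ) := by
  ext i j
  simp [twistedLaplacian, augIncidence_some]

variable [NeZero n]

theorem sum_inv_mul {ψ : AddChar (ZMod n) ℂ} (hψ : ψ.IsPrimitive) (a b : ZMod n) :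
    ∑ s, ψ⁻¹ (a * s) * ψ (s * b) = if a = b then (n : ℂ) else 0 := by
  have h := AddChar.sum_mulShift (b - a) hψ
  rw [ZMod.card] at h
  simp only [sub_eq_zero, eq_comm (a := b)] at h
  rw [Nat.cast_ite, Nat.cast_zero] at h
  rw [← h]
  refine Finset.sum_congr rfl fun s _ => ?_
  rw [AddChar.inv_apply, ← AddChar.map_add_eq_mul]
  congr 1
  ring

theorem sum_mul_right {ψ : AddChar (ZMod n) ℂ} (hψ : ψ.IsPrimitive) (b : ZMod n) :
    ∑ s, ψ (s * b) = if b = 0 then (n : ℂ) else 0 := by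
  have h := sum_inv_mul hψ 0 b
  simpa [eq_comm] using h

theorem sum_inv_mul_left {ψ : AddChar (ZMod n) ℂ} (hψ : ψ.IsPrimitive) (a : ZMod n) :
    ∑ s, ψ⁻¹ (a * s) = if a = 0 then (n : ℂ) else 0 := by
  have h := sum_inv_mul hψ a 0
  simpa using h

variable [Fintype V]

theorem fourier_inv_mul_fourier {ψ : AddChar (ZMod n) ℂ} (hψ : ψ.IsPrimitive) :
    fourier V ψ⁻¹ * fourier V ψ = (n : ℂ) • (1 : Matrix (V × ZMod n) (V × ZMod n) ℂ) := by
  ext ⟨i, a⟩ ⟨j, b⟩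
  simp only [Matrix.mul_apply, fourier, Matrix.of_apply, Fintype.sum_prod_type, ite_mul, zero_mul,
    mul_ite, mul_zero, Matrix.smul_apply, Matrix.one_apply, Prod.mk.injEq, smul_eq_mul, mul_one]
  by_cases hij : i = j
  · subst hij
    simpa [-AddChar.inv_apply] using sum_inv_mul hψ a b
  · simp [hij]

/-- The Fourier transform turns `L + J` for the covering into a block-diagonal matrix with one block
for each character of `ℤ/n`: it multiplies the column of the edge `(e, s)` by a character value and
a vector that does not depend on `s`, so the sum over `s` is that of the orthogonality relations. -/
theorem fourier_mul_laplacian_mul_fourier [Fintype E] (H : OrientedMultigraph V E) (α : E → ℤ)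
    {ψ : AddChar (ZMod n) ℂ} (hψ : ψ.IsPrimitive) :
    fourier V ψ⁻¹ * (Matrix.of fun i j => (1 : ℂ) + ∑ e,
        ((H.cyclicCover α n).augIncidence i (some e) : ℂ) *
          ((H.cyclicCover α n).augIncidence j (some e) : ℂ)) * fourier V ψ =
      (n : ℂ) • Matrix.blockDiagonal (H.twistedLaplacian α ψ) := by
  ext ⟨i, a⟩ ⟨j, b⟩
  rw [mul_laplacian_mul]
  have hleft (e : E) (s : ZMod n) : ∑ x, fourier V ψ⁻¹ (i, a) x *
      ((H.cyclicCover α n).augIncidence x (some (e, s)) : ℂ) = ψ⁻¹ (a * s) *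
        ((if H.tail e = i then 1 else 0) - (if H.head e = i then ψ⁻¹ (a * α e) else 0)) := by
    simp only [augIncidence_some, cyclicCover, Int.cast_sub, Int.cast_ite, Int.cast_one,
      Int.cast_zero, mul_sub, mul_ite, mul_one, mul_zero, Finset.sum_sub_distrib,
      Finset.sum_ite_eq, Finset.mem_univ, if_true, fourier, Matrix.of_apply, eq_comm (a := i),
      mul_add, AddChar.map_add_eq_mul]
  have hright (e : E) (s : ZMod n) : ∑ x, ((H.cyclicCover α n).augIncidence x (some (e, s)) : ℂ) *
      fourier V ψ x (j, b) = ψ (s * b) *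
        ((if H.tail e = j then 1 else 0) - (if H.head e = j then ψ (α e * b) else 0)) := by
    simp_rw [mul_comm _ (fourier V ψ _ _)]
    simp only [augIncidence_some, cyclicCover, Int.cast_sub, Int.cast_ite, Int.cast_one,
      Int.cast_zero, mul_sub, mul_ite, mul_one, mul_zero, Finset.sum_sub_distrib,
      Finset.sum_ite_eq, Finset.mem_univ, if_true, fourier, Matrix.of_apply,
      add_mul, AddChar.map_add_eq_mul]
  have hsuml : ∑ x, fourier V ψ⁻¹ (i, a) x = if a = 0 then (n : ℂ) else 0 := by
    rw [← sum_inv_mul_left hψ]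
    simp only [fourier, Matrix.of_apply, Fintype.sum_prod_type]
    rw [Finset.sum_comm]
    simp
  have hsumr : ∑ x, fourier V ψ x (j, b) = if b = 0 then (n : ℂ) else 0 := by
    rw [← sum_mul_right hψ]
    simp only [fourier, Matrix.of_apply, Fintype.sum_prod_type]
    rw [Finset.sum_comm]
    simp
  have hedges (e : E) : ∑ s, (ψ⁻¹ (a * s) *
        ((if H.tail e = i then 1 else 0) - (if H.head e = i then ψ⁻¹ (a * α e) else 0))) *
      (ψ (s * b) * ((if H.tail e = j then 1 else 0) - (if H.head e = j then ψ (α e * b) else 0))) =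
      (if a = b then (n : ℂ) else 0) *
        (((if H.tail e = i then 1 else 0) - (if H.head e = i then ψ⁻¹ (a * α e) else 0)) *
        ((if H.tail e = j then 1 else 0) - (if H.head e = j then ψ (α e * b) else 0))) := by
    rw [← sum_inv_mul hψ, Finset.sum_mul]
    exact Finset.sum_congr rfl fun s _ => by ring
  rw [hsuml, hsumr, Fintype.sum_prod_type]
  simp only [hleft, hright, hedges]
  rw [← Finset.mul_sum, Matrix.smul_apply, Matrix.blockDiagonal_apply, smul_eq_mul]
  dsimp only
  by_cases hab : a = b
  · subst hab
    by_cases ha : a = 0 <;> simp [ha, twistedLaplacian, mul_add]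
  · by_cases ha : a = 0
    · have hb : b ≠ 0 := fun h => hab (ha.trans h.symm)
      simp [hab, hb]
    · simp [hab, ha]

theorem det_laplacian_cyclicCover [Fintype E] (H : OrientedMultigraph V E) (α : E → ℤ)
    {ψ : AddChar (ZMod n) ℂ} (hψ : ψ.IsPrimitive) :
    (Matrix.of fun i j => (1 : ℂ) + ∑ e,
        ((H.cyclicCover α n).augIncidence i (some e) : ℂ) *
          ((H.cyclicCover α n).augIncidence j (some e) : ℂ)).det =
      ∏ u, (H.twistedLaplacian α ψ u).det := by
  have h := congrArg Matrix.det (H.fourier_mul_laplacian_mul_fourier α hψ)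
  have h1 := congrArg Matrix.det (fourier_inv_mul_fourier (V := V) hψ)
  rw [Matrix.det_mul, Matrix.det_mul, Matrix.det_smul, Matrix.det_blockDiagonal] at h
  rw [Matrix.det_mul, Matrix.det_smul, Matrix.det_one, mul_one] at h1
  rw [mul_right_comm, h1] at h
  exact mul_left_cancel₀ (pow_ne_zero _ (Nat.cast_ne_zero.2 (NeZero.ne n))) h

/-- The matrix-tree theorem, over the complex numbers. -/
theorem det_laplacian_add_const_complex [Nonempty V] [Fintype E] (H : OrientedMultigraph V E)
    (x : ℕ) : (Matrix.of fun i j => (x : ℂ) +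
      ∑ e, (H.augIncidence i (some e) : ℂ) * (H.augIncidence j (some e) : ℂ)).det =
      x * (Fintype.card V : ℂ) ^ 2 * H.toGraph.complexity := by
  have h := congrArg (Int.castRingHom ℂ) (H.det_laplacian_add_const x)
  rw [RingHom.map_det] at h
  convert h using 1
  · congr 1
    ext i j
    simp
  · simp

/-- The nontrivial blocks of the covering's Laplacian are values of the voltage Laplacian. -/
theorem det_twistedLaplacian [Fintype E] (H : OrientedMultigraph V E) (α : E → ℤ) {ε : ℂˣ}
    (hε : (ε : ℂ) ^ n = 1) {u : ZMod n} (hu : u ≠ 0) :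
    (H.twistedLaplacian α (AddChar.zmodChar n hε) u).det =
      LaurentPolynomial.eval₂ (Int.castRingHom ℂ) (ε ^ u.val) (H.voltagePolynomial α) := by
  have hz (m : ℤ) : AddChar.zmodChar n hε (m * u) = (((ε ^ u.val) ^ m : ℂˣ) : ℂ) := by
    rw [← zsmul_eq_mul, AddChar.map_zsmul_eq_zpow, AddChar.zmodChar_apply]
    simp
  have hz' (m : ℤ) : (AddChar.zmodChar n hε)⁻¹ (u * m) = (((ε ^ u.val) ^ (-m) : ℂˣ) : ℂ) := by
    rw [AddChar.inv_apply, ← hz]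
    congr 1
    push_cast
    ring
  rw [voltagePolynomial, RingHom.map_det, RingHom.mapMatrix_apply, map_eval_voltageLaplacian]
  congr 1
  ext i j
  simp only [twistedLaplacian, hz, hz', if_neg hu, zero_add]

end Fourier

end OrientedMultigraph

theorem proposition1 {V E : Type*} [Fintype V] [DecidableEq V] [Fintype E]
    (H : OrientedMultigraph V E) (hH : H.toGraph.IsConnected) (α : E → ℤ)
    (n : ℕ) (hn : 1 ≤ n) (ε : ℂˣ) (hε : IsPrimitiveRoot ε n) :
    ((H.cyclicCover α n).toGraph.complexity : ℂ) =
      (H.toGraph.complexity : ℂ) / (n : ℂ) *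
        ∏ s ∈ Finset.Icc 1 (n - 1),
          LaurentPolynomial.eval₂ (Int.castRingHom ℂ) (ε ^ s) (H.voltagePolynomial α) := by
  have : NeZero n := ⟨by omega⟩
  have : Nonempty V := hH.1.to_type
  have hε' : IsPrimitiveRoot (ε : ℂ) n := IsPrimitiveRoot.coe_units_iff.2 hε
  have hψ := AddChar.zmodChar_primitive_of_primitive_root n hε'
  -- The determinant of `L + J` for the covering: `|V|² n² τ(H_n)` by the matrix-tree theorem, and a
  -- product over the blocks, of which the trivial one is `n |V|² τ(H)`, by the Fourier transform.
  have h := H.det_laplacian_cyclicCover α hψ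
  have htree := (H.cyclicCover α n).det_laplacian_add_const_complex 1
  rw [Nat.cast_one] at htree
  rw [htree, ← Finset.mul_prod_erase _ _ (Finset.mem_univ (0 : ZMod n)),
    OrientedMultigraph.twistedLaplacian_zero, H.det_laplacian_add_const_complex] at h
  have hprod : ∏ u ∈ Finset.univ.erase (0 : ZMod n), (H.twistedLaplacian α
      (AddChar.zmodChar n ((IsPrimitiveRoot.iff_def (ε : ℂ) n).mp hε').left) u).det =
      ∏ s ∈ Finset.Icc 1 (n - 1),
        LaurentPolynomial.eval₂ (Int.castRingHom ℂ) (ε ^ s) (H.voltagePolynomial α) := by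
    refine Finset.prod_nbij' ZMod.val (fun s => (s : ZMod n)) ?_ ?_ ?_ ?_ ?_
    · intro u hu
      have h0 := (ZMod.val_ne_zero u).2 (Finset.ne_of_mem_erase hu)
      have hlt := ZMod.val_lt u
      exact Finset.mem_Icc.2 ⟨by omega, by omega⟩
    · intro s hs
      obtain ⟨h1, h2⟩ := Finset.mem_Icc.1 hs
      refine Finset.mem_erase.2 ⟨fun h => ?_, Finset.mem_univ _⟩
      have := Nat.le_of_dvd (by omega) ((ZMod.natCast_eq_zero_iff s n).1 h)
      omega
    · intro u _
      exact ZMod.natCast_zmod_val u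
    · intro s hs
      exact ZMod.val_cast_of_lt (by have := Finset.mem_Icc.1 hs; omega)
    · intro u hu
      exact H.det_twistedLaplacian α _ (Finset.ne_of_mem_erase hu)
  rw [hprod, Fintype.card_prod, ZMod.card] at h
  have hn0 : (n : ℂ) ≠ 0 := Nat.cast_ne_zero.2 (NeZero.ne n)
  have hV0 : (Fintype.card V : ℂ) ≠ 0 := Nat.cast_ne_zero.2 Fintype.card_ne_zero
  push_cast at h
  field_simp
  refine mul_left_cancel₀ (mul_ne_zero hn0 (pow_ne_zero 2 hV0)) ?_
  linear_combination h
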